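/- There is no triangulation of the $2$-sphere in which exactly one vertex has degree not divisible by $5$. Here a triangulation of the $2$-sphere is a finite abstract simplicial complex of vertices, edges and triangles whose geometric realization is homeomorphic to $\mathbb{S}^2$, and the degree of a vertex is the number of edges containing it. -/

import Mathlib

namespace AbstractSimplicialComplex

/-- The geometric realization of an abstract simplicial complex on a finite vertex set `V`,
as a subset of `V → ℝ`: points given by barycentric coordinates (nonnegative, with sum `1`)
whose set of vertices with nonzero coordinate is a face. It carries the subspace topology. -/
def realization {V : Type*} [Fintype V] (K : AbstractSimplicialComplex V) : Set (V → ℝ) :=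
  {x | x ∈ stdSimplex ℝ V ∧ ∃ s ∈ K, ∀ v : V, v ∈ s ↔ x v ≠ 0}

/-- A triangulation of the 2-sphere: a simplicial complex made of vertices, edges and triangles
whose geometric realization is homeomorphic to the unit sphere of three-dimensional
Euclidean space. -/
structure IsSphereTriangulation {V : Type*} [Fintype V] (K : AbstractSimplicialComplex V) :
    Prop where
  card_le_three : ∀ s ∈ K, s.card ≤ 3
  homeomorphic_sphere :
    Nonempty (K.realization ≃ₜ Metric.sphere (0 : EuclideanSpace ℝ (Fin 3)) 1)

/-- The degree of a vertex: the number of edges that contain it. -/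
noncomputable def degree {V : Type*} (K : AbstractSimplicialComplex V) (v : V) : ℕ :=
  Set.ncard {e : Finset V | e ∈ K ∧ e.card = 2 ∧ v ∈ e}

end AbstractSimplicialComplex

/-! Take involutions `r`, `s`, `t` in a group with `rsr = srs`, `rt = tr` and `st` of order 5;
suitable even permutations of five points exist. Think of them as acting on flags (vertex, edge,
triangle) by changing the vertex, the edge and the triangle respectively. A labelling of flags by
group elements is compatible if each such change multiplies the label on the right by the matching
involution.

The flags at a vertex `v` are the darts of its link, which is a cycle; if 5 divides its length,
compatible labels exist around `v` (`exists_link_labelling`). For adjacent vertices other than `v₀`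
two such labellings differ by a left factor `c u v`, and `rsr = srs` makes `c` a cocycle. The sphere
minus a point is simply connected, so `c` is a coboundary (`exists_potential`) and the labellings
can be corrected to agree. They then induce labels on the flags at `v₀`; one turn around its link
gives `(st) ^ deg v₀ = 1`, so 5 divides this degree as well.

The combinatorial input, that links are connected and 2-regular, is deduced from the homeomorphism
with the sphere by invariance of domain in the plane. -/

open unitInterval Topology

/-! ### Continuous logarithms and invariance of domain in the plane -/

theorem Complex.exists_exp_eq_of_homotopy {A : Type*} [TopologicalSpace A] (H : C(I × A, ℂ))
    (hH : ∀ x, H x ≠ 0) (f : C(A, ℂ)) (hf : ∀ a, Complex.exp (f a) = H (0, a)) :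
    ∃ g : C(A, ℂ), ∀ a, Complex.exp (g a) = H (1, a) := by
  let H' : C(I × A, {z : ℂ // z ≠ 0}) := ⟨fun x => ⟨H x, hH x⟩, by fun_prop⟩
  have h0 : ∀ a, H' (0, a) = ⟨_, (f a).exp_ne_zero⟩ := fun a => Subtype.ext (hf a).symm
  let F := Complex.isCoveringMap_exp.liftHomotopy H' f h0
  refine ⟨F.comp ⟨fun a => (1, a), by fun_prop⟩, fun a => ?_⟩
  have := congrFun (Complex.isCoveringMap_exp.liftHomotopy_lifts H' f h0) (1, a)
  exact congrArg Subtype.val this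

/-- An odd map from the circle to the punctured plane has no continuous logarithm. -/
theorem Complex.not_exists_exp_eq_of_odd {r : ℝ} (hr : 0 < r)
    (g : C(Metric.sphere (0 : ℂ) r, ℂ))
    (hg : ∀ z, Complex.exp (g (-z)) = - Complex.exp (g z)) : False := by
  have : PreconnectedSpace (Metric.sphere (0 : ℂ) r) :=
    isPreconnected_iff_preconnectedSpace.mp
      (isPreconnected_sphere (by simp [Complex.rank_real_complex]) 0 r)
  have hexp : ∀ z, ∃ n : ℤ, g (-z) - g z = Real.pi * Complex.I + n * (2 * Real.pi * Complex.I) := by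
    intro z
    have h : Complex.exp (g (-z)) = Complex.exp (g z + Real.pi * Complex.I) := by
      rw [hg, Complex.exp_add, Complex.exp_pi_mul_I]; ring
    obtain ⟨n, hn⟩ := Complex.exp_eq_exp_iff_exists_int.mp h
    exact ⟨n, by rw [hn]; ring⟩
  -- The integer `n z` is continuous, hence constant on the circle, while exchanging `z` and `-z`
  -- changes the sign of `(2 * n z + 1) * π * I`; so `2 * n z + 1 = 0`.
  choose n hn using hexp
  have hpi : (2 * Real.pi * Complex.I : ℂ) ≠ 0 := Complex.two_pi_I_ne_zero
  have hcont : Continuous n := by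
    have h1 : Continuous (fun z => ((n z : ℤ) : ℂ)) := by
      have : (fun z => ((n z : ℤ) : ℂ)) =
          fun z => (g (-z) - g z - Real.pi * Complex.I) / (2 * Real.pi * Complex.I) := by
        funext z
        rw [hn z]; field_simp; ring
      rw [this]
      fun_prop
    have h2 : Continuous (fun z => ((n z : ℤ) : ℝ)) := by
      have := Complex.continuous_re.comp h1
      simpa [Function.comp_def] using this
    exact Int.isClosedEmbedding_coe_real.isInducing.continuous_iff.mpr h2
  let z : Metric.sphere (0 : ℂ) r := ⟨(r : ℂ), by simp [abs_of_pos hr]⟩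
  have hc : n (-z) = n z := PreconnectedSpace.constant ‹_› hcont
  have h1 := hn z
  have h2 := hn (-z)
  rw [neg_neg, hc] at h2
  have h3 : (2 * n z + 1 : ℂ) * (Real.pi * Complex.I) = 0 := by
    linear_combination (-1 / 2 : ℂ) * h1 - (1 / 2 : ℂ) * h2
  rcases mul_eq_zero.mp h3 with h | h
  · have : (2 * n z + 1 : ℤ) = 0 := by exact_mod_cast h
    omega
  · exact hpi (by linear_combination 2 * h)

/-- Invariance of domain in the plane. -/
theorem Complex.mem_interior_image_closedBall {f : ℂ → ℂ} {p : ℂ} {r : ℝ} (hr : 0 < r)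
    (hf : ContinuousOn f (Metric.closedBall p r)) (hinj : Set.InjOn f (Metric.closedBall p r)) :
    f p ∈ interior (f '' Metric.closedBall p r) := by
  have hmem : ∀ (z : Metric.sphere (0 : ℂ) r) (t : ℝ), |t| ≤ 1 →
      p + t * z ∈ Metric.closedBall p r := by
    intro z t ht
    have hz : ‖(z : ℂ)‖ = r := by simp
    simp only [Metric.mem_closedBall, dist_self_add_left, norm_mul, hz, Complex.norm_real,
      Real.norm_eq_abs]
    nlinarith
  have hcomp : ∀ {A : Type} [TopologicalSpace A] (t : A → ℝ) (z : A → Metric.sphere (0 : ℂ) r),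
      Continuous t → Continuous z → (∀ a, |t a| ≤ 1) → Continuous fun a => f (p + t a * z a) := by
    intro A _ t z ht hz hle
    exact hf.comp_continuous (by fun_prop) fun a => hmem _ _ (hle a)
  have hz0 : ∀ z : Metric.sphere (0 : ℂ) r, (z : ℂ) ≠ 0 := fun z => ne_zero_of_mem_sphere hr.ne' z
  have hpmem : p ∈ Metric.closedBall p r := by simp [hr.le]
  -- the loop `f(p + z) - f(p)` has no logarithm
  have hnolog : ∀ g : C(Metric.sphere (0 : ℂ) r, ℂ),
      (∀ z, Complex.exp (g z) = f (p + z) - f p) → False := by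
    intro g hg
    -- The two arguments of `f` always differ by `z ≠ 0`, so injectivity keeps `H` away from zero.
    -- At time 1 it is `f (p + z/2) - f (p - z/2)`, which is odd.
    let H : C(I × Metric.sphere (0 : ℂ) r, ℂ) :=
      ⟨fun x => f (p + ((1 / (1 + x.1) : ℝ) : ℂ) * x.2) - f (p + ((-x.1 / (1 + x.1) : ℝ) : ℂ) * x.2),
        by
          have hne : ∀ x : I × Metric.sphere (0 : ℂ) r, (1 + (x.1 : ℝ)) ≠ 0 := fun x => by
            have := x.1.2.1; positivity
          refine (hcomp _ _ ?_ continuous_snd fun x => ?_).sub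
            (hcomp _ _ ?_ continuous_snd fun x => ?_)
          · fun_prop (disch := exact hne)
          · have := x.1.2.1
            rw [abs_of_nonneg (by positivity), div_le_one (by positivity)]; linarith
          · fun_prop (disch := exact hne)
          · have := x.1.2.1
            rw [abs_div, abs_neg, abs_of_nonneg this, abs_of_nonneg (by positivity : 0 ≤ 1 + (x.1 : ℝ)),
              div_le_one (by positivity)]; linarith⟩
    obtain ⟨g', hg'⟩ := Complex.exists_exp_eq_of_homotopy H (fun x => by
      have := x.1.2.1
      refine sub_ne_zero.mpr fun h => ?_
      have h := hinj (hmem _ _ ?_) (hmem _ _ ?_) h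
      · have h := mul_right_cancel₀ (hz0 x.2) (add_left_cancel h)
        have h : (1 / (1 + x.1) : ℝ) = -x.1 / (1 + x.1) := by exact_mod_cast h
        have h := (div_left_inj' (by positivity)).mp h
        linarith
      · rw [abs_of_nonneg (by positivity), div_le_one (by positivity)]; linarith
      · rw [abs_div, abs_neg, abs_of_nonneg this, abs_of_nonneg (by positivity : 0 ≤ 1 + (x.1 : ℝ)),
              div_le_one (by positivity)]; linarith) g (fun z => by simp [H, hg])
    refine Complex.not_exists_exp_eq_of_odd hr g' fun z => ?_
    rw [hg', hg']
    simp only [H, ContinuousMap.coe_mk]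
    norm_num
  -- the minimal distance from `f p` to the image of the boundary
  have hS : IsCompact (Metric.sphere p r) := isCompact_sphere p r
  have hSsub : Metric.sphere p r ⊆ Metric.closedBall p r := Metric.sphere_subset_closedBall
  have hclosed : IsClosed (f '' Metric.sphere p r) := (hS.image_of_continuousOn (hf.mono hSsub)).isClosed
  have hnot : f p ∈ (f '' Metric.sphere p r)ᶜ := by
    rintro ⟨w, hw, h⟩
    have := hinj (hSsub hw) hpmem h
    subst this
    simp at hw; exact hr.ne hw
  obtain ⟨ε, hε, hball⟩ := Metric.isOpen_iff.mp hclosed.isOpen_compl _ hnot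
  refine mem_interior_iff_mem_nhds.mpr (Metric.mem_nhds_iff.mpr ⟨ε, hε, fun q hq => ?_⟩)
  by_contra hqn
  have hne : ∀ w ∈ Metric.closedBall p r, f w - q ≠ 0 := fun w hw h =>
    hqn ⟨w, hw, sub_eq_zero.mp h⟩
  -- If `q` is not a value of `f`, contracting the circle to `p` joins `f (p + z) - q` to a nonzero
  -- constant, so it has a logarithm.
  let H : C(I × Metric.sphere (0 : ℂ) r, ℂ) :=
    ⟨fun x => f (p + ((x.1 : ℝ) : ℂ) * x.2) - q, (hcomp (fun x : I × Metric.sphere (0 : ℂ) r => (x.1 : ℝ))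
      Prod.snd (by fun_prop) (by fun_prop) (fun x => by rw [abs_of_nonneg x.1.2.1]; exact x.1.2.2)).sub
        continuous_const⟩
  obtain ⟨g, hg⟩ := Complex.exists_exp_eq_of_homotopy H (fun x => hne _ (hmem _ _
      (by rw [abs_of_nonneg x.1.2.1]; exact x.1.2.2)))
    (.const _ (Complex.log (f p - q))) (fun z => by
      simp only [H, ContinuousMap.const_apply, ContinuousMap.coe_mk]
      rw [Complex.exp_log (hne p hpmem)]; simp)
  have hsm : ∀ z : Metric.sphere (0 : ℂ) r, p + z ∈ Metric.sphere p r := fun z => by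
    simp
  have hd0 : ∀ z : Metric.sphere (0 : ℂ) r, f (p + z) - q ≠ 0 := fun z => hne _ (hSsub (hsm z))
  have hd1 : ∀ z : Metric.sphere (0 : ℂ) r, f (p + z) - f p ≠ 0 := fun z h => by
    exact hnot ⟨_, hsm z, sub_eq_zero.mp h⟩
  -- The quotient is within distance less than 1 of 1, so its principal logarithm is continuous;
  -- subtracting it moves the logarithm from the base point `q` to `f p`.
  have hslit : ∀ z : Metric.sphere (0 : ℂ) r,
      (f (p + z) - q) / (f (p + z) - f p) ∈ Complex.slitPlane := by
    intro z
    have : (f (p + z) - q) / (f (p + z) - f p) = 1 + (f p - q) / (f (p + z) - f p) := by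
      field_simp [hd1 z]; ring
    rw [this]
    refine Complex.mem_slitPlane_of_norm_lt_one ?_
    rw [norm_div, div_lt_one (norm_pos_iff.mpr (hd1 z))]
    have h1 : ‖f p - q‖ < ε := by rw [← dist_eq_norm, dist_comm]; exact hq
    by_contra! h2
    refine hball ?_ ⟨_, hsm z, rfl⟩
    rw [Metric.mem_ball, dist_eq_norm]; linarith
  have hfc : Continuous fun z : Metric.sphere (0 : ℂ) r => f (p + z) := by
    refine (hf.mono hSsub).comp_continuous (by fun_prop) hsm
  refine hnolog ⟨fun z => g z - Complex.log ((f (p + z) - q) / (f (p + z) - f p)), ?_⟩ fun z => ?_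
  · refine g.continuous.sub (Continuous.clog ?_ hslit)
    exact (hfc.sub continuous_const).div (hfc.sub continuous_const) hd1
  · simp only [ContinuousMap.coe_mk]
    rw [Complex.exp_sub, hg, Complex.exp_log (Complex.slitPlane_ne_zero (hslit z))]
    simp only [H, ContinuousMap.coe_mk]
    have := hd0 z
    have := hd1 z
    simp
    field_simp

theorem Complex.isPreconnected_ball_diff_singleton (p : ℂ) (r : ℝ) :
    IsPreconnected (Metric.ball p r \ {p}) := by
  have h1 : IsPreconnected (Metric.sphere (0 : ℂ) 1) :=
    isPreconnected_sphere (by simp [Complex.rank_real_complex]) 0 1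
  have h := ((isPreconnected_Ioo (a := (0 : ℝ)) (b := r)).prod h1).image
    (fun x : ℝ × ℂ => p + x.1 * x.2) (by fun_prop)
  convert h using 1
  ext z
  simp only [Set.mem_sdiff, Metric.mem_ball, Set.mem_singleton_iff, Set.mem_image, Set.mem_prod,
    Set.mem_Ioo, mem_sphere_zero_iff_norm, Prod.exists]
  constructor
  · rintro ⟨hz, hne⟩
    have h1 : ‖z - p‖ ≠ 0 := by simpa [sub_eq_zero] using hne
    have h0 : (‖z - p‖ : ℂ) ≠ 0 := by exact_mod_cast h1
    refine ⟨‖z - p‖, (z - p) / ‖z - p‖, ⟨⟨?_, ?_⟩, ?_⟩, ?_⟩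
    · simpa [sub_eq_zero] using hne
    · rwa [← dist_eq_norm]
    · rw [norm_div]; simp [div_self h1]
    · field_simp; ring
  · rintro ⟨t, u, ⟨⟨ht0, htr⟩, hu⟩, rfl⟩
    constructor
    · simp [hu, abs_of_pos ht0, htr]
    · have : u ≠ 0 := by rintro rfl; simp at hu
      simp [ht0.ne', this]

/-! ### Planar charts of the realization -/

namespace AbstractSimplicialComplex

/-- Three pairwise distinct vertices that span a face. -/
def IsTriangle {V : Type*} [DecidableEq V] (K : AbstractSimplicialComplex V) (a b c : V) : Prop :=
  a ≠ b ∧ a ≠ c ∧ b ≠ c ∧ {a, b, c} ∈ K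

theorem mem_of_subset {V : Type*} (K : AbstractSimplicialComplex V) {s t : Finset V}
    (hs : s ∈ K) (hts : t ⊆ s) (ht : t.Nonempty) : t ∈ K :=
  (K.isRelLowerSet_faces hs).2 hts ht

section IsTriangle

variable {V : Type*} [DecidableEq V] {K : AbstractSimplicialComplex V} {a b c : V}

theorem IsTriangle.swap₁₂ (h : K.IsTriangle a b c) : K.IsTriangle b a c :=
  ⟨h.1.symm, h.2.2.1, h.2.1, by rw [Finset.insert_comm]; exact h.2.2.2⟩

theorem IsTriangle.swap₂₃ (h : K.IsTriangle a b c) : K.IsTriangle a c b :=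
  ⟨h.2.1, h.1, h.2.2.1.symm, by rw [Finset.pair_comm]; exact h.2.2.2⟩

theorem IsTriangle.edge_mem (h : K.IsTriangle a b c) : {a, b} ∈ K :=
  K.mem_of_subset h.2.2.2 (by grind) (by simp)

end IsTriangle

theorem nhdsWithin_diff_singleton_of_ne {V : Type*} {q x : V → ℝ} (h : x ≠ q) (s : Set (V → ℝ)) :
    𝓝[s \ {q}] x = 𝓝[s] x := by
  rw [Set.sdiff_eq]
  exact nhdsWithin_inter_of_mem' (mem_nhdsWithin_of_mem_nhds (isOpen_compl_singleton.mem_nhds h))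

section Realization

variable {V : Type*} [Fintype V] {K : AbstractSimplicialComplex V}

theorem mem_realization_of_subset {x : V → ℝ} (hx : x ∈ stdSimplex ℝ V) {s : Finset V}
    (hs : s ∈ K) (h : ∀ v, x v ≠ 0 → v ∈ s) : x ∈ K.realization := by
  refine ⟨hx, Finset.univ.filter (fun v => x v ≠ 0), K.mem_of_subset hs (fun v hv => ?_) ?_, ?_⟩
  · exact h v (by simpa using hv)
  · by_contra! h0
    have : ∑ v, x v = 0 := Finset.sum_eq_zero fun v _ => by
      by_contra hv
      have : v ∈ Finset.univ.filter (fun v => x v ≠ 0) := by simpa using hv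
      simp [h0] at this
    rw [hx.2] at this
    exact one_ne_zero this
  · simp

theorem mem_of_mem_realization {x : V → ℝ} (hx : x ∈ K.realization) {s : Finset V}
    (hs : s.Nonempty) (h : ∀ v ∈ s, x v ≠ 0) : s ∈ K := by
  obtain ⟨-, t, ht, hxt⟩ := hx
  exact K.mem_of_subset ht (fun v hv => (hxt v).mpr (h v hv)) hs

/-- Stereographic projection from the image of `q`. The map `e` takes the default value 0 off the
realization, so that it can be defined on the ambient space. -/
theorem exists_chart (hK : K.IsSphereTriangulation) {q : V → ℝ} (hq : q ∈ K.realization) :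
    ∃ (e : (V → ℝ) → ℂ) (e' : ℂ → V → ℝ), ContinuousOn e (K.realization \ {q}) ∧ Continuous e' ∧
      (∀ z, e' z ∈ K.realization \ {q}) ∧ (∀ z, e (e' z) = z) ∧
      ∀ x ∈ K.realization \ {q}, e' (e x) = x := by
  classical
  obtain ⟨φ⟩ := hK.homeomorphic_sphere
  have : Fact (Module.finrank ℝ (EuclideanSpace ℝ (Fin 3)) = 2 + 1) := ⟨by simp⟩
  let χ := stereographic' 2 (φ ⟨q, hq⟩)
  let ψ : EuclideanSpace ℝ (Fin 2) ≃ₜ ℂ := Complex.orthonormalBasisOneI.repr.symm.toHomeomorph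
  have hsrc : ∀ x (hx : x ∈ K.realization \ {q}), φ ⟨x, hx.1⟩ ∈ χ.source := by
    intro x hx
    simp only [χ, stereographic'_source, Set.mem_compl_iff, Set.mem_singleton_iff,
      EmbeddingLike.apply_eq_iff_eq, Subtype.mk.injEq]
    exact hx.2
  have htgt : ∀ y, y ∈ χ.target := fun y => by simp [χ]
  refine ⟨fun x => if h : x ∈ K.realization then ψ (χ (φ ⟨x, h⟩)) else 0,
    fun z => (φ.symm (χ.symm (ψ.symm z))).1, ?_, ?_, fun z => ⟨Subtype.coe_prop _, ?_⟩,
    fun z => ?_, fun x hx => ?_⟩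
  · rw [continuousOn_iff_continuous_domRestrict]
    have h1 : Continuous fun x : (K.realization \ {q} : Set (V → ℝ)) => χ (φ ⟨x.1, x.2.1⟩) :=
      χ.continuousOn.comp_continuous (by fun_prop) fun x => hsrc x.1 x.2
    refine (ψ.continuous.comp h1).congr fun x => ?_
    simp only [Function.comp_apply, Set.domRestrict_apply]
    rw [dif_pos x.2.1]
  · have h1 : Continuous fun z => χ.symm (ψ.symm z) :=
      χ.continuousOn_symm.comp_continuous (by fun_prop) fun z => htgt _
    exact continuous_subtype_val.comp (φ.symm.continuous.comp h1)
  · intro h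
    have h1 := χ.map_target (htgt (ψ.symm z))
    simp only [χ, stereographic'_source, Set.mem_compl_iff, Set.mem_singleton_iff] at h1
    apply h1
    rw [← φ.symm_apply_eq]
    exact Subtype.ext h
  · simp [χ.right_inv (htgt _)]
  · simp [hx.1, χ.left_inv (hsrc x hx)]

/-- Invariance of domain for discs mapped into the sphere; it will show that two triangles on an
edge leave no room for a third. -/
theorem image_closedBall_mem_nhdsWithin (hK : K.IsSphereTriangulation) {q : V → ℝ}
    (hq : q ∈ K.realization) {g : ℂ → V → ℝ} {p : ℂ} {r : ℝ} (hr : 0 < r)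
    (hg : ContinuousOn g (Metric.closedBall p r)) (hinj : Set.InjOn g (Metric.closedBall p r))
    (hmaps : Set.MapsTo g (Metric.closedBall p r) (K.realization \ {q})) :
    g '' Metric.closedBall p r ∈ 𝓝[K.realization] (g p) := by
  obtain ⟨e, e', he, -, -, -, hinv⟩ := exists_chart hK hq
  have hp : p ∈ Metric.closedBall p r := by simp [hr.le]
  have hinjE : Set.InjOn e (K.realization \ {q}) := fun x hx y hy hxy => by
    rw [← hinv x hx, hxy, hinv y hy]
  have := Complex.mem_interior_image_closedBall hr (he.comp hg hmaps) (hinjE.comp hinj hmaps)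
  rw [← nhdsWithin_diff_singleton_of_ne (hmaps hp).2]
  have h2 := (he _ (hmaps hp)).preimage_mem_nhdsWithin (isOpen_interior.mem_nhds this)
  filter_upwards [h2, self_mem_nhdsWithin] with x hx hxm
  obtain ⟨w, hw, hwx⟩ := interior_subset hx
  exact ⟨w, hw, hinjE (hmaps hw) hxm hwx⟩

/-- Invariance of domain for maps from the sphere to the plane; it will exclude edges lying in fewer
than two triangles. -/
theorem mem_interior_image (hK : K.IsSphereTriangulation) {q x : V → ℝ}
    (hq : q ∈ K.realization) (hx : x ∈ K.realization) (hxq : x ≠ q) {N : Set (V → ℝ)}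
    (hN : N ∈ 𝓝[K.realization] x) {F : (V → ℝ) → ℂ} (hF : ContinuousOn F N)
    (hinj : Set.InjOn F N) : F x ∈ interior (F '' N) := by
  obtain ⟨e, e', -, he', hmem, hright, hinv⟩ := exists_chart hK hq
  have hx' : e' (e x) = x := hinv x ⟨hx, hxq⟩
  have h1 : e' ⁻¹' N ∈ 𝓝 (e x) := by
    have : Filter.Tendsto e' (𝓝 (e x)) (𝓝[K.realization] x) := by
      refine tendsto_nhdsWithin_iff.mpr ⟨?_, Filter.Eventually.of_forall fun z => (hmem z).1⟩
      have := he'.tendsto (e x)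
      rwa [hx'] at this
    exact this hN
  obtain ⟨r, hr, hball⟩ := Metric.nhds_basis_closedBall.mem_iff.mp h1
  have := Complex.mem_interior_image_closedBall hr (f := F ∘ e')
    (hF.comp he'.continuousOn hball)
    (hinj.comp (fun z _ w _ h => by rw [← hright z, h, hright w]) hball)
  rw [Function.comp_apply, hx'] at this
  refine interior_mono ?_ this
  rw [Set.image_comp]
  exact Set.image_mono (Set.image_subset_iff.mpr hball)

/-- In a chart, a small disc around `x` stays connected when its centre is removed. -/
theorem not_locally_separated (hK : K.IsSphereTriangulation) {q x : V → ℝ}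
    (hq : q ∈ K.realization) (hx : x ∈ K.realization) (hxq : x ≠ q) {N P Q : Set (V → ℝ)}
    (hN : N ∈ 𝓝[K.realization] x) (hP : IsOpen P) (hQ : IsOpen Q)
    (hcover : ∀ y ∈ N, y ≠ x → y ∈ P ∨ y ∈ Q) (hdisj : ∀ y ∈ N, y ∈ P → y ∉ Q)
    (hxP : x ∈ closure ((K.realization ∩ P) \ {x})) (hxQ : x ∈ closure ((K.realization ∩ Q) \ {x})) :
    False := by
  obtain ⟨e, e', he, he', hmem, hright, hinv⟩ := exists_chart hK hq
  have hx' : e' (e x) = x := hinv x ⟨hx, hxq⟩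
  have h1 : e' ⁻¹' N ∈ 𝓝 (e x) := by
    have : Filter.Tendsto e' (𝓝 (e x)) (𝓝[K.realization] x) := by
      refine tendsto_nhdsWithin_iff.mpr ⟨?_, Filter.Eventually.of_forall fun z => (hmem z).1⟩
      have := he'.tendsto (e x)
      rwa [hx'] at this
    exact this hN
  obtain ⟨r, hr, hball⟩ := Metric.nhds_basis_ball.mem_iff.mp h1
  have hne : ∀ z, z ≠ e x → e' z ≠ x := fun z hz h => hz (by rw [← h, hright])
  have hmeet : ∀ R : Set (V → ℝ), x ∈ closure ((K.realization ∩ R) \ {x}) →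
      ((Metric.ball (e x) r \ {e x}) ∩ e' ⁻¹' R).Nonempty := by
    intro R hR
    have h2 : e ⁻¹' Metric.ball (e x) r ∈ 𝓝[K.realization] x := by
      rw [← nhdsWithin_diff_singleton_of_ne hxq]
      exact (he x ⟨hx, hxq⟩).preimage_mem_nhdsWithin (Metric.ball_mem_nhds _ hr)
    obtain ⟨U, hU, hUsub⟩ := mem_nhdsWithin_iff_exists_mem_nhds_inter.mp h2
    obtain ⟨y, ⟨hyU, hyq⟩, ⟨hyK, hyR⟩, hyx⟩ := mem_closure_iff_nhds.mp hR _
      (Filter.inter_mem hU (isOpen_compl_singleton.mem_nhds hxq))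
    have hy' := hinv y ⟨hyK, hyq⟩
    refine ⟨e y, ⟨hUsub ⟨hyU, hyK⟩, fun h => hyx ?_⟩, ?_⟩
    · rw [Set.mem_singleton_iff] at h
      rw [Set.mem_singleton_iff, ← hy', h, hx']
    · rw [Set.mem_preimage, hy']; exact hyR
  obtain ⟨z, hz, hzP, hzQ⟩ := Complex.isPreconnected_ball_diff_singleton (e x) r _ _
    (hP.preimage he') (hQ.preimage he')
    (fun z hz => hcover _ (hball hz.1) (hne z hz.2)) (hmeet P hxP) (hmeet Q hxQ)
  exact hdisj _ (hball hz.1) hzP hzQ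

variable [DecidableEq V]

/-- The point with barycentric coordinates `r`, `s`, `t` at the vertices `a`, `b`, `c`. -/
noncomputable def baryPoint (a b c : V) (r s t : ℝ) : V → ℝ :=
  r • Pi.single a (1 : ℝ) + s • Pi.single b (1 : ℝ) + t • Pi.single c (1 : ℝ)

theorem baryPoint_mem {a b c : V} (h : {a, b, c} ∈ K) {r s t : ℝ} (hr : 0 ≤ r) (hs : 0 ≤ s)
    (ht : 0 ≤ t) (hsum : r + s + t = 1) : baryPoint a b c r s t ∈ K.realization := by
  have hnn : ∀ (r : ℝ), 0 ≤ r → ∀ u v : V, 0 ≤ (r • Pi.single u (1 : ℝ) : V → ℝ) v := by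
    intro r hr u v
    simp only [Pi.smul_apply, Pi.single_apply, smul_eq_mul]
    split_ifs <;> simp [hr]
  refine mem_realization_of_subset ⟨fun v => ?_, ?_⟩ h fun v hv => ?_
  · exact add_nonneg (add_nonneg (hnn _ hr _ _) (hnn _ hs _ _)) (hnn _ ht _ _)
  · simp [baryPoint, Finset.sum_add_distrib, ← Finset.mul_sum, Finset.sum_pi_single', hsum]
  · by_contra hv'
    simp only [Finset.mem_insert, Finset.mem_singleton, not_or] at hv'
    exact hv (by simp [baryPoint, hv'])

theorem single_mem_realization (K : AbstractSimplicialComplex V) (v : V) :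
    Pi.single v (1 : ℝ) ∈ K.realization := by
  have := baryPoint_mem (K := K) (a := v) (b := v) (c := v) (by simpa using show {v} ∈ K from K.singleton_mem v)
    zero_le_one le_rfl le_rfl (by simp)
  simpa [baryPoint] using this

end Realization

end AbstractSimplicialComplex

/-! ### Local structure: triangles on an edge, connectedness of links -/

namespace AbstractSimplicialComplex

theorem continuous_baryPoint {V : Type*} [DecidableEq V] (a b c : V) {A : Type*} [TopologicalSpace A] {r s t : A → ℝ}
    (hr : Continuous r) (hs : Continuous s) (ht : Continuous t) :
    Continuous fun x => baryPoint a b c (r x) (s x) (t x) := by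
  unfold baryPoint
  fun_prop

theorem isOpen_pos {V : Type*} (a : V) : IsOpen {x : V → ℝ | 0 < x a} :=
  isOpen_lt continuous_const (continuous_apply a)

theorem sum_eq_one_of_support {V : Type*} [Fintype V] {K : AbstractSimplicialComplex V}
    {x : V → ℝ} (hx : x ∈ K.realization) {s : Finset V}
    (h : ∀ v, v ∉ s → x v = 0) : ∑ v ∈ s, x v = 1 := by
  rw [← hx.1.2]
  exact Finset.sum_subset (Finset.subset_univ s) fun v _ hv => h v hv

theorem sum_le_one {V : Type*} [Fintype V] {K : AbstractSimplicialComplex V}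
    {x : V → ℝ} (hx : x ∈ K.realization) (s : Finset V) : ∑ v ∈ s, x v ≤ 1 := by
  rw [← hx.1.2]
  exact Finset.sum_le_sum_of_subset_of_nonneg (Finset.subset_univ s) fun v _ _ => hx.1.1 v

section LocalStructure

variable {V : Type*} [Fintype V] [DecidableEq V] {K : AbstractSimplicialComplex V}

theorem isTriangle_of_mem_realization {x : V → ℝ} (hx : x ∈ K.realization) {a b c : V}
    (hab : a ≠ b) (hac : a ≠ c) (hbc : b ≠ c) (ha : x a ≠ 0) (hb : x b ≠ 0) (hc : x c ≠ 0) :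
    K.IsTriangle a b c := by
  refine ⟨hab, hac, hbc, mem_of_mem_realization hx (by simp) fun v hv => ?_⟩
  simp only [Finset.mem_insert, Finset.mem_singleton] at hv
  rcases hv with rfl | rfl | rfl <;> assumption

/-- With at most one triangle on the edge, the coordinates at `a` and `b` determine a point near the
midpoint `m`. Then `F` embeds a neighbourhood of `m` in the closed upper half plane with `F m` on
its boundary, so `F m` cannot be interior to the image. -/
theorem exists_two_triangles (hK : K.IsSphereTriangulation) {a b : V} (hab : a ≠ b)
    (h : {a, b} ∈ K) : ∃ c d, c ≠ d ∧ K.IsTriangle a b c ∧ K.IsTriangle a b d := by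
  classical
  by_contra! hcon
  have huniq : ∀ c d, K.IsTriangle a b c → K.IsTriangle a b d → c = d := fun c d hc hd => by
    by_contra hcd
    exact hcon c d hcd hc hd
  let m := baryPoint a b b (1 / 2) (1 / 2) 0
  have hm : m ∈ K.realization :=
    baryPoint_mem (by simpa using h) (by norm_num) (by norm_num) le_rfl (by norm_num)
  have hma : m a = 1 / 2 := by simp [m, baryPoint, hab]
  have hmb : m b = 1 / 2 := by simp [m, baryPoint, hab]
  have hmq : m ≠ Pi.single a 1 := fun h => by
    have := congrFun h b
    rw [hmb] at this
    simp [hab.symm] at this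
  let N : Set (V → ℝ) := ({x | 0 < x a} ∩ {x | 0 < x b}) ∩ K.realization
  have hN : N ∈ 𝓝[K.realization] m :=
    Filter.inter_mem (mem_nhdsWithin_of_mem_nhds
      (((isOpen_pos a).inter (isOpen_pos b)).mem_nhds ⟨by simp [hma], by simp [hmb]⟩))
      self_mem_nhdsWithin
  let F : (V → ℝ) → ℂ := fun x => x a + (1 - x a - x b : ℝ) * Complex.I
  have hre : ∀ x, (F x).re = x a := fun x => by simp [F]
  have him : ∀ x, (F x).im = 1 - x a - x b := fun x => by simp [F]
  have hFc : Continuous F := by fun_prop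
  have hval : ∀ x ∈ N, ∀ v, x v =
      if v = a then x a else if v = b then x b else
        if K.IsTriangle a b v then 1 - x a - x b else 0 := by
    rintro x ⟨⟨hxa, hxb⟩, hx⟩ v
    split_ifs with h1 h2 h3
    · rw [h1]
    · rw [h2]
    · have := sum_eq_one_of_support hx (s := {a, b, v}) fun w hw => by
        by_contra hw0
        simp only [Finset.mem_insert, Finset.mem_singleton, not_or] at hw
        exact hw.2.2 (huniq _ _ (isTriangle_of_mem_realization hx hab (Ne.symm hw.1)
          (Ne.symm hw.2.1) (ne_of_gt hxa) (ne_of_gt hxb) hw0) h3)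
      rw [Finset.sum_insert (by simp [hab, Ne.symm h1]), Finset.sum_insert (by simp [Ne.symm h2]),
        Finset.sum_singleton] at this
      linarith
    · by_contra hv
      exact h3 (isTriangle_of_mem_realization hx hab (Ne.symm h1) (Ne.symm h2)
        (ne_of_gt hxa) (ne_of_gt hxb) hv)
  have hinj : Set.InjOn F N := by
    intro x hx y hy hxy
    have h1 : x a = y a := by rw [← hre x, hxy, hre]
    have h2 : x b = y b := by
      have := congrArg Complex.im hxy
      rw [him, him] at this
      linarith
    funext v
    rw [hval x hx, hval y hy, h1, h2]
  have hint := mem_interior_image hK (K.single_mem_realization a) hm hmq hN hFc.continuousOn hinj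
  obtain ⟨ε, hε, hball⟩ := Metric.mem_nhds_iff.mp (mem_interior_iff_mem_nhds.mp hint)
  have : F m - (ε / 2 : ℝ) * Complex.I ∈ Metric.ball (F m) ε := by
    rw [Metric.mem_ball, dist_eq_norm]
    simp only [sub_sub_cancel_left, norm_neg, norm_mul, Complex.norm_real, Complex.norm_I, mul_one,
      Real.norm_eq_abs]
    rw [abs_of_pos (by positivity)]
    linarith
  obtain ⟨x, hx, hxF⟩ := hball this
  have h1 := congrArg Complex.im hxF
  have h2 := sum_le_one hx.2 {a, b}
  rw [Finset.sum_pair hab] at h2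
  rw [Complex.sub_im, him, him, hma, hmb] at h1
  simp at h1
  linarith

/-- The triangles `abc` and `abd`, unfolded along `ab` by the sign of `z.im`, contain a disc around
the midpoint that is already a neighbourhood. Points of `abe` tending to the midpoint have positive
coordinate at `e` and are missed by it. -/
theorem IsTriangle.eq_or_eq (hK : K.IsSphereTriangulation) {a b c d e : V} (hcd : c ≠ d)
    (hc : K.IsTriangle a b c) (hd : K.IsTriangle a b d) (he : K.IsTriangle a b e) :
    e = c ∨ e = d := by
  by_contra! hne
  obtain ⟨hec, hed⟩ := hne
  obtain ⟨hab, hac, hbc, hmc⟩ := hc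
  obtain ⟨-, had, hbd, hmd⟩ := hd
  obtain ⟨-, hae, hbe, hme⟩ := he
  let g : ℂ → V → ℝ := fun z => baryPoint a b c ((1 - |z.im|) / 2 + z.re) ((1 - |z.im|) / 2 - z.re)
    (max z.im 0) + max (-z.im) 0 • Pi.single d (1 : ℝ)
  have hgc : Continuous g := by
    have := continuous_baryPoint a b c (r := fun z : ℂ => (1 - |z.im|) / 2 + z.re)
      (s := fun z : ℂ => (1 - |z.im|) / 2 - z.re) (t := fun z : ℂ => max z.im 0)
      (by fun_prop) (by fun_prop) (by fun_prop)
    exact this.add (by fun_prop)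
  have hga : ∀ z, g z a = (1 - |z.im|) / 2 + z.re := fun z => by
    simp [g, baryPoint, hab, hac, had]
  have hgb : ∀ z, g z b = (1 - |z.im|) / 2 - z.re := fun z => by
    simp [g, baryPoint, hab, hbc, hbd]
  have hgcc : ∀ z, g z c = max z.im 0 := fun z => by
    simp [g, baryPoint, hac.symm, hbc.symm, hcd]
  have hgd : ∀ z, g z d = max (-z.im) 0 := fun z => by
    simp [g, baryPoint, had.symm, hbd.symm, hcd.symm]
  have hge : ∀ z, g z e = 0 := fun z => by
    simp [g, baryPoint, hae.symm, hbe.symm, hec, hed]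
  have hinj : Function.Injective g := by
    intro z w hzw
    have h1 : z.re = w.re := by
      have h1 := congrFun hzw a
      have h2 := congrFun hzw b
      rw [hga, hga] at h1
      rw [hgb, hgb] at h2
      linarith
    have h2 : z.im = w.im := by
      rw [← max_zero_sub_max_neg_zero_eq_self z.im, ← max_zero_sub_max_neg_zero_eq_self w.im, ← hgcc,
        ← hgd, ← hgcc, ← hgd, hzw]
    exact Complex.ext h1 h2
  -- Radius 1/4 keeps the coordinates at `a` and `b` nonnegative, as `(1 - 1/4) / 2 ≥ 1/4`.
  have hmaps : Set.MapsTo g (Metric.closedBall 0 (1 / 4)) (K.realization \ {Pi.single e 1}) := by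
    intro z hz
    have hz' : ‖z‖ ≤ 1 / 4 := by simpa using hz
    have h1 := (abs_le.mp (Complex.abs_re_le_norm z))
    have h2 := Complex.abs_im_le_norm z
    refine ⟨?_, fun h => ?_⟩
    · rcases le_total 0 z.im with him | him
      · have : g z = baryPoint a b c ((1 - |z.im|) / 2 + z.re) ((1 - |z.im|) / 2 - z.re) |z.im| := by
          simp [g, him, abs_of_nonneg him]
        rw [this]
        exact baryPoint_mem hmc (by linarith) (by linarith) (abs_nonneg _) (by ring)
      · have : g z = baryPoint a b d ((1 - |z.im|) / 2 + z.re) ((1 - |z.im|) / 2 - z.re) |z.im| := by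
          simp [g, him, abs_of_nonpos him, baryPoint]
        rw [this]
        exact baryPoint_mem hmd (by linarith) (by linarith) (abs_nonneg _) (by ring)
    · have := congrFun h e
      rw [hge] at this
      simp at this
  have hnhds := image_closedBall_mem_nhdsWithin hK (K.single_mem_realization e)
    (by norm_num) hgc.continuousOn hinj.injOn hmaps
  let y : ℝ → V → ℝ := fun t => baryPoint a b e ((1 - t) / 2) ((1 - t) / 2) t
  have hy : Continuous y := continuous_baryPoint a b e (by fun_prop) (by fun_prop) (by fun_prop)
  have hy0 : y 0 = g 0 := by simp [y, g, baryPoint]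
  have htend : Filter.Tendsto y (𝓝[>] 0) (𝓝[K.realization] (g 0)) := by
    refine tendsto_nhdsWithin_iff.mpr ⟨?_, ?_⟩
    · rw [← hy0]
      exact hy.continuousAt.continuousWithinAt
    · filter_upwards [Ioo_mem_nhdsGT (zero_lt_one' ℝ)] with t ht
      exact baryPoint_mem hme (by linarith [ht.2]) (by linarith [ht.2]) ht.1.le (by ring)
  obtain ⟨t, ⟨z, -, hz⟩, ht⟩ := 
    ((htend.eventually hnhds).and self_mem_nhdsWithin).exists
  have h1 := congrFun hz e
  rw [hge] at h1
  have : y t e = t := by simp [y, baryPoint, hae.symm, hbe.symm]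
  rw [this] at h1
  exact ne_of_lt ht h1

/-- In a triangulated sphere each edge lies in exactly two triangles. -/
theorem exists_isTriangle_iff (hK : K.IsSphereTriangulation) {a b : V} (hab : a ≠ b)
    (h : {a, b} ∈ K) : ∃ c d, c ≠ d ∧ ∀ e, K.IsTriangle a b e ↔ e = c ∨ e = d := by
  obtain ⟨c, d, hcd, hc, hd⟩ := exists_two_triangles hK hab h
  refine ⟨c, d, hcd, fun e => ⟨hc.eq_or_eq hK hcd hd, ?_⟩⟩
  rintro (rfl | rfl) <;> assumption

/-- In a triangulated sphere the links of the vertices are connected. -/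
theorem mem_of_link_closed (hK : K.IsSphereTriangulation) {v a b : V} (hva : v ≠ a) (hvb : v ≠ b)
    (ha : {v, a} ∈ K) (hb : {v, b} ∈ K) {A : Set V} (haA : a ∈ A)
    (hA : ∀ c d, c ∈ A → K.IsTriangle v c d → d ∈ A) : b ∈ A := by
  by_contra hbA
  -- `P` and `Q` would split the punctured open star of `v`: a common point would lie over a
  -- triangle at `v` with one vertex in `A` and one outside.
  let P : Set (V → ℝ) := ⋃ w ∈ {w | w ∈ A ∧ w ≠ v}, {x | 0 < x w}
  let Q : Set (V → ℝ) := ⋃ w ∈ {w | w ∉ A ∧ w ≠ v}, {x | 0 < x w}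
  let N : Set (V → ℝ) := {x | 0 < x v} ∩ K.realization
  have hN : N ∈ 𝓝[K.realization] (Pi.single v 1) :=
    Filter.inter_mem (mem_nhdsWithin_of_mem_nhds ((isOpen_pos v).mem_nhds (by simp)))
      self_mem_nhdsWithin
  have hclos : ∀ R : Set (V → ℝ), ∀ c, v ≠ c → {v, c} ∈ K → (∀ x : V → ℝ, 0 < x c → x ∈ R) →
      Pi.single v 1 ∈ closure ((K.realization ∩ R) \ {Pi.single v 1}) := by
    intro R c hvc hc hR
    let y : ℝ → V → ℝ := fun t => baryPoint v c c (1 - t) t 0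
    have hy : Continuous y := continuous_baryPoint v c c (by fun_prop) (by fun_prop) (by fun_prop)
    have hy0 : y 0 = Pi.single v 1 := by simp [y, baryPoint]
    have htend : Filter.Tendsto y (𝓝[>] 0) (𝓝 (Pi.single v 1)) := by
      rw [← hy0]
      exact hy.continuousAt.continuousWithinAt
    refine mem_closure_of_tendsto htend ?_
    filter_upwards [Ioo_mem_nhdsGT (zero_lt_one' ℝ)] with t ht
    have hyc : y t c = t := by simp [y, baryPoint, hvc.symm]
    refine ⟨⟨baryPoint_mem (by simpa using hc) (by linarith [ht.2]) ht.1.le le_rfl (by ring),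
      hR _ (by rw [hyc]; exact ht.1)⟩, fun h => ?_⟩
    have := congrFun h c
    rw [hyc] at this
    simp [hvc.symm] at this
    exact ht.1.ne' this
  refine not_locally_separated hK (q := Pi.single a 1) (x := Pi.single v 1) (N := N) (P := P)
    (Q := Q) (K.single_mem_realization a) (K.single_mem_realization v) ?_ hN
    (isOpen_biUnion fun w _ => isOpen_pos w) (isOpen_biUnion fun w _ => isOpen_pos w) ?_ ?_
    (hclos P a hva ha fun x hx => ?_) (hclos Q b hvb hb fun x hx => ?_)
  · intro h
    have := congrFun h v
    simp [hva] at this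
  · rintro x ⟨-, hx⟩ hxv
    by_contra! hcon
    simp only [P, Q, Set.mem_iUnion₂, not_exists, Set.mem_ofPred_eq] at hcon
    have h0 : ∀ w, w ≠ v → x w = 0 := by
      intro w hw
      by_contra hxw
      have hpos : 0 < x w := lt_of_le_of_ne (hx.1.1 w) (Ne.symm hxw)
      by_cases hwA : w ∈ A
      · exact hcon.1 w ⟨hwA, hw⟩ hpos
      · exact hcon.2 w ⟨hwA, hw⟩ hpos
    apply hxv
    have hsum := sum_eq_one_of_support hx (s := {v}) (by simpa using h0)
    funext w
    by_cases hw : w = v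
    · subst hw; simpa using hsum
    · rw [h0 w hw]; simp [hw]
  · rintro x ⟨hxv, hx⟩ hxP hxQ
    simp only [P, Q, Set.mem_iUnion₂, Set.mem_ofPred_eq] at hxP hxQ
    obtain ⟨w, ⟨hwA, hwv⟩, hw⟩ := hxP
    obtain ⟨u, ⟨huA, huv⟩, hu⟩ := hxQ
    exact huA (hA w u hwA (isTriangle_of_mem_realization hx (Ne.symm hwv) (Ne.symm huv)
      (fun h => huA (h ▸ hwA)) (ne_of_gt hxv) hw.ne' hu.ne'))
  · exact Set.mem_biUnion ⟨haA, hva.symm⟩ hx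
  · exact Set.mem_biUnion ⟨hbA, hvb.symm⟩ hx

end LocalStructure

end AbstractSimplicialComplex

/-! ### The covering of a cocycle and its triviality -/

namespace AbstractSimplicialComplex

section Covering

variable {V : Type*} [Fintype V] [DecidableEq V] (K : AbstractSimplicialComplex V) (v₀ : V)
  {G : Type*} [Group G] (c : V → V → G)

open Classical in
/-- The total space of the covering of the realization minus a vertex `v₀` that is defined by the
cocycle `c`. The second component of a point records the value at each vertex of the support. -/
def CocycleCover : Type _ :=
  {y : ↥(K.realization \ {Pi.single v₀ (1 : ℝ)}) × (V → G → ℝ) // ∃ h : V → G,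
    (∀ u g, y.2 u g = y.1.1 u * if u ≠ v₀ ∧ g = h u then 1 else 0) ∧
    ∀ u w, u ≠ v₀ → w ≠ v₀ → y.1.1 u ≠ 0 → y.1.1 w ≠ 0 → h u * c u w = h w}

namespace CocycleCover

variable {K v₀ c}

noncomputable instance : TopologicalSpace (CocycleCover K v₀ c) := instTopologicalSpaceSubtype

/-- The covering map. -/
def proj (y : CocycleCover K v₀ c) : ↥(K.realization \ {Pi.single v₀ (1 : ℝ)}) := y.1.1

theorem continuous_proj : Continuous (proj : CocycleCover K v₀ c → _) :=
  continuous_fst.comp continuous_subtype_val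

/-- The value of a point of the covering at the vertices of the support. -/
noncomputable def value (y : CocycleCover K v₀ c) : V → G := y.2.choose

open Classical in
theorem snd_apply (y : CocycleCover K v₀ c) (u : V) (g : G) :
    y.1.2 u g = (proj y).1 u * if u ≠ v₀ ∧ g = value y u then 1 else 0 :=
  y.2.choose_spec.1 u g

theorem value_mul (y : CocycleCover K v₀ c) {u w : V} (hu : u ≠ v₀) (hw : w ≠ v₀)
    (hyu : (proj y).1 u ≠ 0) (hyw : (proj y).1 w ≠ 0) : value y u * c u w = value y w :=
  y.2.choose_spec.2 u w hu hw hyu hyw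

/-- Hence at vertices of the support `value` does not depend on the chosen witness; elsewhere it is
arbitrary. -/
theorem snd_ne_zero_iff (y : CocycleCover K v₀ c) {u : V} (hu : u ≠ v₀) (hyu : (proj y).1 u ≠ 0)
    (g : G) : y.1.2 u g ≠ 0 ↔ value y u = g := by
  rw [snd_apply]
  simp [hu, hyu, eq_comm (a := g)]

theorem continuous_value [TopologicalSpace G] [DiscreteTopology G] {A : Type*} [TopologicalSpace A]
    {f : A → CocycleCover K v₀ c} (hf : Continuous f) {u : V} (hu : u ≠ v₀)
    (h : ∀ a, (proj (f a)).1 u ≠ 0) : Continuous fun a => value (f a) u := by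
  refine continuous_discrete_rng.mpr fun g => ?_
  have : (fun a => value (f a) u) ⁻¹' {g} = {a | (f a).1.2 u g ≠ 0} := by
    ext a
    exact (snd_ne_zero_iff _ hu (h a) g).symm
  rw [this]
  have hc : Continuous fun a => (f a).1.2 u g := by
    have h1 : Continuous fun a => (f a).1.2 := continuous_snd.comp (continuous_subtype_val.comp hf)
    exact (continuous_apply g).comp ((continuous_apply u).comp h1)
  exact isOpen_ne_fun hc continuous_const

open Classical in
/-- The point over `x` with value `g` at the vertex `v`. -/
noncomputable def lift
    (hc : ∀ u v w, u ≠ v₀ → v ≠ v₀ → w ≠ v₀ → {u, v, w} ∈ K → c u v * c v w = c u w)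
    {v : V} (hv : v ≠ v₀) (x : ↥(K.realization \ {Pi.single v₀ (1 : ℝ)})) (hx : x.1 v ≠ 0)
    (g : G) : CocycleCover K v₀ c :=
  ⟨(x, fun u g' => x.1 u * if u ≠ v₀ ∧ g' = g * c v u then 1 else 0), fun u => g * c v u,
    fun _ _ => rfl, fun u w hu hw hxu hxw => by
      rw [mul_assoc, hc v u w hv hu hw]
      refine mem_of_mem_realization x.2.1 (by simp) fun z hz => ?_
      simp only [Finset.mem_insert, Finset.mem_singleton] at hz
      rcases hz with rfl | rfl | rfl <;> assumption⟩

/-- Where the coordinate at `v` is nonzero, the value at `v` trivializes the covering, since the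
cocycle recovers all other values on the support. The factor `x u` in the second component makes the
value at `u` fade out as `u` leaves the support, which gives continuity of the inverse. -/
theorem isCoveringMap_proj
    (hc : ∀ u v w, u ≠ v₀ → v ≠ v₀ → w ≠ v₀ → {u, v, w} ∈ K → c u v * c v w = c u w) :
    IsCoveringMap (proj : CocycleCover K v₀ c → _) := by
  classical
  let _ : TopologicalSpace G := ⊥
  have : DiscreteTopology G := ⟨rfl⟩
  intro x
  obtain ⟨v, hv, hxv⟩ : ∃ v, v ≠ v₀ ∧ x.1 v ≠ 0 := by
    by_contra! hcon
    have h1 := sum_eq_one_of_support x.2.1 (s := {v₀}) (by simpa using hcon)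
    refine x.2.2 (funext fun w => ?_)
    by_cases hw : w = v₀
    · subst hw; simpa using h1
    · rw [hcon w hw]; simp [hw]
  have hcvv : c v v = 1 := by
    have := hc v v v hv hv hv (by simpa using show {v} ∈ K from K.singleton_mem v)
    simpa using this
  let U : Set ↥(K.realization \ {Pi.single v₀ (1 : ℝ)}) := {y | y.1 v ≠ 0}
  have hU : IsOpen U := isOpen_ne_fun ((continuous_apply v).comp continuous_subtype_val) continuous_const
  let H : (proj : CocycleCover K v₀ c → _) ⁻¹' U ≃ₜ U × G :=
    { toFun := fun y => (⟨proj y.1, y.2⟩, value y.1 v)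
      invFun := fun z => ⟨lift hc hv z.1.1 z.1.2 z.2, z.1.2⟩
      left_inv := by
        rintro ⟨y, hy⟩
        refine Subtype.ext (Subtype.ext (Prod.ext rfl ?_))
        funext u g
        rw [snd_apply y]
        change (proj y).1 u * _ = _
        by_cases hu : u = v₀
        · simp [hu]
        · by_cases hyu : (proj y).1 u = 0
          · simp [hyu]
          · rw [value_mul y hv hu hy hyu]
      right_inv := by
        rintro ⟨⟨x, hx⟩, g⟩
        refine Prod.ext rfl ?_
        refine (snd_ne_zero_iff (lift hc hv x hx g) hv hx g).mp ?_
        change x.1 v * (if v ≠ v₀ ∧ g = g * c v v then 1 else 0) ≠ 0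
        have hx' : x.1 v ≠ 0 := hx
        simp [hcvv, hv, hx']
      continuous_toFun := by
        refine Continuous.prodMk ?_ (continuous_value continuous_subtype_val hv fun y => y.2)
        exact (continuous_proj.comp continuous_subtype_val).subtype_mk _
      continuous_invFun := by
        refine Continuous.subtype_mk (Continuous.subtype_mk (Continuous.prodMk (by fun_prop) ?_) _) _
        refine continuous_pi fun u => continuous_pi fun g => Continuous.mul ?_ ?_
        · exact (continuous_apply u).comp
            (continuous_subtype_val.comp (continuous_subtype_val.comp continuous_fst))
        · exact (continuous_of_discreteTopology
            (f := fun g' : G => if u ≠ v₀ ∧ g = g' * c v u then (1 : ℝ) else 0)).comp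
            continuous_snd }
  have : IsEvenlyCovered (proj : CocycleCover K v₀ c → _) x G :=
    ⟨inferInstance, U, hxv, hU, hU.preimage continuous_proj, H, fun _ => rfl⟩
  exact this.to_isEvenlyCovered_preimage

end CocycleCover

variable {K v₀ c}

/-- A cocycle on a triangulated sphere minus the open star of a vertex is a coboundary. -/
theorem exists_potential (hK : K.IsSphereTriangulation)
    (hc : ∀ u v w, u ≠ v₀ → v ≠ v₀ → w ≠ v₀ → {u, v, w} ∈ K → c u v * c v w = c u w) :
    ∃ h : V → G, ∀ u v, u ≠ v → u ≠ v₀ → v ≠ v₀ → {u, v} ∈ K → h u * c u v = h v := by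
  classical
  let _ : TopologicalSpace G := ⊥
  have : DiscreteTopology G := ⟨rfl⟩
  by_cases hne : ∃ a : V, a ≠ v₀
  swap
  · push Not at hne
    exact ⟨fun _ => 1, fun u v huv => absurd ((hne u).trans (hne v).symm) huv⟩
  obtain ⟨a, ha⟩ := hne
  obtain ⟨e, e', he, he', hmem, -, hinv⟩ := exists_chart hK (K.single_mem_realization v₀)
  have hvert : ∀ u, u ≠ v₀ → (Pi.single u 1 : V → ℝ) ∈ K.realization \ {Pi.single v₀ (1 : ℝ)} := by
    refine fun u hu => ⟨K.single_mem_realization u, fun h => ?_⟩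
    have := congrFun h u
    simp [hu] at this
  let f : C(ℂ, ↥(K.realization \ {Pi.single v₀ (1 : ℝ)})) := ⟨fun z => ⟨e' z, hmem z⟩, by fun_prop⟩
  -- The plane is simply connected, so the inverse chart lifts; composed with the chart, the lift is
  -- a global section `S`.
  obtain ⟨F, ⟨-, hF⟩, -⟩ :=
    (CocycleCover.isCoveringMap_proj hc).existsUnique_continuousMap_lifts f (e (Pi.single a 1))
      (CocycleCover.lift hc ha ⟨_, hvert a ha⟩ (by simp) 1)
      (Subtype.ext (hinv _ (hvert a ha)).symm)
  let S : ↥(K.realization \ {Pi.single v₀ (1 : ℝ)}) → CocycleCover K v₀ c := fun x => F (e x.1)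
  have hS : Continuous S := F.continuous.comp (continuousOn_iff_continuous_domRestrict.mp he)
  have hpS : ∀ x, CocycleCover.proj (S x) = x := fun x => by
    have := congrFun hF (e x.1)
    exact this.trans (Subtype.ext (hinv _ x.2))
  have hedge : ∀ u v, u ≠ v → u ≠ v₀ → v ≠ v₀ → {u, v} ∈ K → ∀ t : I,
      baryPoint u v v (1 - t / 2) (t / 2) 0 ∈ K.realization \ {Pi.single v₀ (1 : ℝ)} := by
    intro u v huv hu hv huvK t
    have h0 := t.2.1
    have h1 := t.2.2
    refine ⟨baryPoint_mem (by simpa using huvK) (by linarith) (by linarith) le_rfl (by ring), ?_⟩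
    intro h
    have := congrFun h v₀
    simp [baryPoint, hu.symm, hv.symm] at this
  -- On the half edge from `u` to the midpoint the coordinate at `u` is nonzero, so the discrete
  -- value at `u` is constant. At the midpoint the values at both ends are defined and differ by `c
  -- u v`.
  have hconst : ∀ u v (huv : u ≠ v) (hu : u ≠ v₀) (hv : v ≠ v₀) (huvK : {u, v} ∈ K),
      CocycleCover.value (S ⟨_, hedge u v huv hu hv huvK 1⟩) u =
        CocycleCover.value (S ⟨_, hvert u hu⟩) u := by
    intro u v huv hu hv huvK
    have hcont : Continuous fun t : I =>
        CocycleCover.value (S ⟨_, hedge u v huv hu hv huvK t⟩) u := by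
      refine CocycleCover.continuous_value (hS.comp (Continuous.subtype_mk
        (continuous_baryPoint u v v (by fun_prop) (by fun_prop) (by fun_prop)) _)) hu fun t => ?_
      rw [Function.comp_apply, hpS]
      have h1 := t.2.2
      have : baryPoint u v v (1 - t / 2 : ℝ) (t / 2) 0 u = 1 - t / 2 := by
        simp [baryPoint, huv]
      simp only [this]
      exact (by linarith : (0 : ℝ) < 1 - t / 2).ne'
    have h01 := PreconnectedSpace.constant inferInstance hcont (x := 1) (y := 0)
    refine h01.trans ?_
    congr 3
    simp [baryPoint]
  refine ⟨fun u => if hu : u ≠ v₀ then CocycleCover.value (S ⟨_, hvert u hu⟩) u else 1,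
    fun u v huv hu hv huvK => ?_⟩
  beta_reduce
  rw [dif_pos hu, dif_pos hv, ← hconst u v huv hu hv huvK,
    ← hconst v u huv.symm hv hu (by rwa [Finset.pair_comm])]
  have hmid : (⟨_, hedge v u huv.symm hv hu (by rwa [Finset.pair_comm]) 1⟩ :
      ↥(K.realization \ {Pi.single v₀ (1 : ℝ)})) = ⟨_, hedge u v huv hu hv huvK 1⟩ := by
    refine Subtype.ext ?_
    simp only [baryPoint, Set.Icc.coe_one, zero_smul, add_zero]
    rw [add_comm]
    norm_num
  rw [hmid]
  refine CocycleCover.value_mul _ hu hv ?_ ?_ <;> rw [hpS]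
  · simp only [baryPoint]
    simp [huv]
    norm_num
  · simp only [baryPoint]
    simp [huv.symm]

end Covering

end AbstractSimplicialComplex

/-! ### Cycles and labellings of their darts -/

/-- A finite connected graph in which each vertex has exactly two neighbours is a cycle. -/
theorem exists_cyclic_parametrization {X : Type*} [Finite X] [Nonempty X] {R : X → X → Prop}
    (hsymm : ∀ a b, R a b → R b a) (hirr : ∀ a, ¬ R a a)
    (htwo : ∀ a, ∃ c d, c ≠ d ∧ ∀ e, R a e ↔ e = c ∨ e = d)
    (hconn : ∀ A : Set X, A.Nonempty → (∀ a b, a ∈ A → R a b → b ∈ A) → ∀ a, a ∈ A) :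
    ∃ w : ℤ → X, Function.Surjective w ∧ (∀ i, w (i + 1) ≠ w (i - 1)) ∧
      (∀ i b, R (w i) b ↔ b = w (i + 1) ∨ b = w (i - 1)) ∧
      ∀ i j, w i = w j ↔ (Nat.card X : ℤ) ∣ i - j := by
  have hother : ∀ a b, ∃ c, R a b → c ≠ b ∧ ∀ e, R a e ↔ e = b ∨ e = c := by
    intro a b
    obtain ⟨c, d, hcd, h⟩ := htwo a
    by_cases hb : R a b
    · rcases (h b).mp hb with rfl | rfl
      · exact ⟨d, fun _ => ⟨hcd.symm, h⟩⟩
      · exact ⟨c, fun _ => ⟨hcd, fun e => by rw [h, or_comm]⟩⟩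
    · exact ⟨b, fun h => absurd h hb⟩
  choose o ho using hother
  have hoR : ∀ a b, R a b → R a (o a b) := fun a b h => ((ho a b h).2 _).mpr (Or.inr rfl)
  have hoo : ∀ a b, R a b → o a (o a b) = b := fun a b h => by
    have h1 := ho a _ (hoR a b h)
    rcases (h1.2 b).mp h with h2 | h2
    · exact absurd h2.symm (ho a b h).1
    · exact h2.symm
  -- `o a b` is the neighbour of `a` other than `b`; `ρ` advances a dart by one step without turning
  -- back.
  let ρ : Equiv.Perm {d : X × X // R d.1 d.2} :=
    { toFun := fun d => ⟨(d.1.2, o d.1.2 d.1.1), hoR _ _ (hsymm _ _ d.2)⟩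
      invFun := fun d => ⟨(o d.1.1 d.1.2, d.1.1), hsymm _ _ (hoR _ _ d.2)⟩
      left_inv := fun d => Subtype.ext (Prod.ext (hoo _ _ (hsymm _ _ d.2)) rfl)
      right_inv := fun d => Subtype.ext (Prod.ext rfl (hoo _ _ d.2)) }
  obtain ⟨a₀⟩ := ‹Nonempty X›
  obtain ⟨b₀, _, _, hb₀⟩ := htwo a₀
  let d₀ : {d : X × X // R d.1 d.2} := ⟨(a₀, b₀), (hb₀ b₀).mpr (Or.inl rfl)⟩
  let w : ℤ → X := fun i => ((ρ ^ i) d₀).1.1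
  have hsnd : ∀ i, ((ρ ^ i) d₀).1.2 = w (i + 1) := fun i => by
    change _ = ((ρ ^ (i + 1)) d₀).1.1
    rw [add_comm i 1, zpow_one_add, Equiv.Perm.mul_apply]
    rfl
  have hR : ∀ i, R (w i) (w (i + 1)) := fun i => by
    rw [← hsnd]; exact ((ρ ^ i) d₀).2
  have hR' : ∀ i, R (w i) (w (i - 1)) := fun i => by
    have := hsymm _ _ (hR (i - 1))
    rwa [sub_add_cancel] at this
  have hstep : ∀ i, w (i + 1) = o (w i) (w (i - 1)) := fun i => by
    have h1 := hsnd i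
    have h2 : ρ ^ i = ρ * ρ ^ (i - 1) := by rw [← zpow_one_add]; congr 1; ring
    rw [h2, Equiv.Perm.mul_apply] at h1
    rw [← h1]
    change o ((ρ ^ (i - 1)) d₀).1.2 _ = _
    rw [hsnd, sub_add_cancel]
  have hne : ∀ i, w (i + 1) ≠ w (i - 1) := fun i => by
    rw [hstep]; exact (ho _ _ (hR' i)).1
  have hnbr : ∀ i b, R (w i) b ↔ b = w (i + 1) ∨ b = w (i - 1) := fun i b => by
    rw [hstep, (ho _ _ (hR' i)).2, or_comm]
  have hsurj : Function.Surjective w := by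
    intro a
    refine hconn (Set.range w) ⟨_, 0, rfl⟩ ?_ a
    rintro _ b ⟨i, rfl⟩ hb
    rcases (hnbr i b).mp hb with rfl | rfl <;> exact ⟨_, rfl⟩
  have hprev : ∀ i, w (i - 1) = o (w i) (w (i + 1)) := fun i => by
    rw [hstep, hoo _ _ (hR' i)]
  -- A walk returning in the opposite direction would retrace itself, `w (i + k) = w (j - k)`;
  -- halfway it would turn back (`j - i` even) or stand still (`j - i` odd).
  have hdir : ∀ i j, w i = w j → w (i + 1) = w (j + 1) := by
    intro i j hij
    wlog hle : i ≤ j generalizing i j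
    · exact (this j i hij.symm (le_of_not_ge hle)).symm
    by_contra hcon
    have h1 : w (i + 1) = w (j - 1) :=
      ((hnbr j (w (i + 1))).mp (hij ▸ hR i)).resolve_left hcon
    have hrev : ∀ k : ℕ, w (i + k) = w (j - k) ∧ w (i + k + 1) = w (j - k - 1) := by
      intro k
      induction k with
      | zero => simpa using ⟨hij, h1⟩
      | succ k ih =>
        have h3 := hstep (i + k + 1)
        have h4 := hprev (j - k - 1)
        rw [add_sub_cancel_right, ih.1, ih.2] at h3
        rw [sub_add_cancel] at h4
        push_cast
        rw [← add_assoc, ← sub_sub]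
        exact ⟨ih.2, h3.trans h4.symm⟩
    obtain ⟨n, hn⟩ := Int.eq_ofNat_of_zero_le (sub_nonneg.mpr hle)
    rcases Nat.even_or_odd' n with ⟨t, ht | ht⟩
    · have h5 := (hrev t).2
      rw [show j - (t : ℤ) - 1 = i + t - 1 by omega] at h5
      exact hne _ h5
    · have h5 := (hrev t).1
      rw [show j - (t : ℤ) = i + t + 1 by omega] at h5
      have := hR (i + t)
      rw [← h5] at this
      exact hirr _ this
  let m := Function.minimalPeriod (fun d => ρ • d) d₀
  have hm : 0 < m := Nat.pos_of_ne_zero (MulAction.minimalPeriod_pos ρ d₀).out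
  have hper : ∀ i j, w i = w j ↔ (m : ℤ) ∣ i - j := by
    intro i j
    have h1 : (m : ℤ) ∣ i - j ↔ (ρ ^ i) d₀ = (ρ ^ j) d₀ := by
      rw [← MulAction.zpow_smul_eq_iff_minimalPeriod_dvd, Equiv.Perm.smul_def, sub_eq_neg_add,
        zpow_add, zpow_neg, Equiv.Perm.mul_apply, Equiv.Perm.inv_eq_iff_eq]
    rw [h1]
    refine ⟨fun h => Subtype.ext (Prod.ext h ?_), fun h => congrArg (fun d => d.1.1) h⟩
    rw [hsnd, hsnd]
    exact hdir i j h
  have hcard : Nat.card X = m := by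
    have : Function.Bijective fun k : Fin m => w k := by
      refine ⟨fun k l hkl => ?_, fun a => ?_⟩
      · have h1 := (hper _ _).mp hkl
        have h3 := Int.emod_eq_emod_iff_emod_sub_eq_zero.mpr (Int.emod_eq_zero_of_dvd h1)
        rw [Int.emod_eq_of_lt (by positivity) (by exact_mod_cast k.2),
          Int.emod_eq_of_lt (by positivity) (by exact_mod_cast l.2)] at h3
        exact Fin.ext (by exact_mod_cast h3)
      · obtain ⟨i, rfl⟩ := hsurj a
        have hm' : (0 : ℤ) < m := by exact_mod_cast hm
        have h1 := Int.emod_nonneg i hm'.ne'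
        have h2 := Int.emod_lt_of_pos i hm'
        refine ⟨⟨(i % m).toNat, by omega⟩, (hper _ _).mpr ?_⟩
        simp only [Int.toNat_of_nonneg h1]
        exact ⟨-(i / m), by linarith [Int.emod_add_mul_ediv i m]⟩
    rw [← Nat.card_eq_of_bijective _ this, Nat.card_fin]
  exact ⟨w, hsurj, hne, hnbr, fun i j => by rw [hper, hcard]⟩

section CyclicLabelling

variable {X : Type*} [Finite X] {R : X → X → Prop}

/-- A 2-regular connected graph whose number of vertices is divisible by `n` has a labelling of the
darts that is equivariant under a pair of involutions whose product has `n`-th power `1`. -/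
theorem exists_dart_labelling (hsymm : ∀ a b, R a b → R b a) (hirr : ∀ a, ¬ R a a)
    (htwo : ∀ a, ∃ c d, c ≠ d ∧ ∀ e, R a e ↔ e = c ∨ e = d)
    (hconn : ∀ A : Set X, A.Nonempty → (∀ a b, a ∈ A → R a b → b ∈ A) → ∀ a, a ∈ A)
    {G : Type*} [Group G] {s t : G} (hs : s * s = 1) (ht : t * t = 1) {n : ℕ}
    (hst : (s * t) ^ n = 1) (hn : n ∣ Nat.card X) :
    ∃ φ : X → X → G, (∀ a b, R a b → φ b a = φ a b * s) ∧
      ∀ a b c, R a b → R a c → b ≠ c → φ a c = φ a b * t := by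
  classical
  cases isEmpty_or_nonempty X
  · exact ⟨fun _ _ => 1, fun a => isEmptyElim a, fun a => isEmptyElim a⟩
  obtain ⟨w, hsurj, hne, hnbr, hper⟩ := exists_cyclic_parametrization hsymm hirr htwo hconn
  have hpow : ∀ i j, w i = w j → (s * t) ^ i = (s * t) ^ j := by
    intro i j h
    obtain ⟨k, hk⟩ := (Int.natCast_dvd_natCast.mpr hn).trans ((hper i j).mp h)
    rw [← mul_inv_eq_one, ← zpow_sub, hk, zpow_mul, zpow_natCast, hst, one_zpow]
  have hsucc : ∀ i j, w i = w j → w (i + 1) = w (j + 1) := fun i j h =>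
    (hper _ _).mpr (by simpa using (hper i j).mp h)
  have hpred : ∀ i j, w i = w j → w (i - 1) = w (j - 1) := fun i j h =>
    (hper _ _).mpr (by simpa using (hper i j).mp h)
  choose idx hidx using hsurj
  -- Forward darts at `w i` get `(s * t) ^ i`, backward ones `(s * t) ^ (i - 1) * s`. The choice of
  -- `idx` is immaterial because `n` divides the length of the cycle.
  let φ : X → X → G := fun a b =>
    if b = w (idx a + 1) then (s * t) ^ idx a else (s * t) ^ (idx a - 1) * s
  have hφ : ∀ i, φ (w i) (w (i + 1)) = (s * t) ^ i := fun i => by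
    have h := hidx (w i)
    simp only [φ]
    rw [if_pos (hsucc _ _ h).symm, hpow _ _ h]
  have hφ' : ∀ i, φ (w i) (w (i - 1)) = (s * t) ^ (i - 1) * s := fun i => by
    have h := hidx (w i)
    simp only [φ]
    rw [if_neg, hpow _ _ (hpred _ _ h)]
    rw [hsucc _ _ h]
    exact (hne i).symm
  have hss : ∀ g : G, g * s * s = g := fun g => by rw [mul_assoc, hs, mul_one]
  have htt : ∀ g : G, g * t * t = g := fun g => by rw [mul_assoc, ht, mul_one]
  have hpm : ∀ i : ℤ, (s * t) ^ (i - 1) * s * t = (s * t) ^ i := fun i => by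
    rw [mul_assoc, ← zpow_add_one, sub_add_cancel]
  refine ⟨φ, fun a b hab => ?_, fun a b c hab hac hbc => ?_⟩
  · rw [← hidx a] at hab ⊢
    rcases (hnbr _ _).mp hab with rfl | rfl
    · rw [hφ]
      have := hφ' (idx a + 1)
      rwa [add_sub_cancel_right] at this
    · rw [hφ', hss]
      have := hφ (idx a - 1)
      rwa [sub_add_cancel] at this
  · rw [← hidx a] at hab hac ⊢
    rcases (hnbr _ _).mp hab with rfl | rfl <;> rcases (hnbr _ _).mp hac with rfl | rfl
    · exact absurd rfl hbc
    · rw [hφ, hφ', ← hpm (idx a), htt]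
    · rw [hφ, hφ', hpm]
    · exact absurd rfl hbc

/-- Each step along the cycle multiplies the label by `s * t`, and one full turn returns to the
initial dart. -/
theorem orderOf_dvd_card_of_dart_labelling (hsymm : ∀ a b, R a b → R b a) (hirr : ∀ a, ¬ R a a)
    (htwo : ∀ a, ∃ c d, c ≠ d ∧ ∀ e, R a e ↔ e = c ∨ e = d)
    (hconn : ∀ A : Set X, A.Nonempty → (∀ a b, a ∈ A → R a b → b ∈ A) → ∀ a, a ∈ A)
    {G : Type*} [Group G] {s t : G} {φ : X → X → G} (h₁ : ∀ a b, R a b → φ b a = φ a b * s)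
    (h₂ : ∀ a b c, R a b → R a c → b ≠ c → φ a c = φ a b * t) :
    orderOf (s * t) ∣ Nat.card X := by
  cases isEmpty_or_nonempty X
  · simp
  obtain ⟨w, -, hne, hnbr, hper⟩ := exists_cyclic_parametrization hsymm hirr htwo hconn
  have hR : ∀ i, R (w i) (w (i + 1)) := fun i => (hnbr _ _).mpr (Or.inl rfl)
  have hstep : ∀ i, φ (w (i + 1)) (w (i + 1 + 1)) = φ (w i) (w (i + 1)) * (s * t) := fun i => by
    have h3 := hne (i + 1)
    rw [add_sub_cancel_right] at h3
    rw [h₂ _ _ _ (hsymm _ _ (hR i)) (hR (i + 1)) h3.symm, h₁ _ _ (hR i), mul_assoc]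
  have hiter : ∀ k : ℕ, φ (w k) (w (k + 1)) = φ (w 0) (w 1) * (s * t) ^ k := by
    intro k
    induction k with
    | zero => simp
    | succ k ih =>
      push_cast
      rw [hstep, ih, pow_succ, mul_assoc]
  have h0 : w (Nat.card X : ℤ) = w 0 := (hper _ _).mpr (by simp)
  have h1 : w ((Nat.card X : ℤ) + 1) = w 1 := (hper _ _).mpr (by simp)
  have := hiter (Nat.card X)
  rw [h0, h1] at this
  exact orderOf_dvd_of_pow_eq_one (left_eq_mul.mp this)

end CyclicLabelling

/-- The alternating group `A₅` is a quotient of the full icosahedral group, in which the rotation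
about a vertex keeps its order `5`. -/
theorem exists_icosahedral_reflections : ∃ r s t : Equiv.Perm (Fin 5), r * r = 1 ∧ s * s = 1 ∧
    t * t = 1 ∧ r * s * r = s * r * s ∧ r * t = t * r ∧ orderOf (s * t) = 5 := by
  have : Fact (Nat.Prime 5) := ⟨by norm_num⟩
  refine ⟨Equiv.swap 1 2 * Equiv.swap 3 4, Equiv.swap 0 1 * Equiv.swap 3 4,
    Equiv.swap 1 3 * Equiv.swap 2 4, by decide, by decide, by decide, by decide, by decide,
    orderOf_eq_prime (by decide) (by decide)⟩

/-! ### Flag labellings around vertices and their gluing -/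

namespace AbstractSimplicialComplex

/-- The vertices adjacent to `v`. -/
abbrev Neighbor {V : Type*} [DecidableEq V] (K : AbstractSimplicialComplex V) (v : V) : Type _ := {a : V // v ≠ a ∧ {v, a} ∈ K}

theorem card_neighbor {V : Type*} [DecidableEq V] (K : AbstractSimplicialComplex V) (v : V) :
    Nat.card (K.Neighbor v) = K.degree v := by
  have : {e : Finset V | e ∈ K ∧ e.card = 2 ∧ v ∈ e} =
      (fun a => {v, a}) '' {a : V | v ≠ a ∧ {v, a} ∈ K} := by
    ext e
    constructor
    · rintro ⟨he, hcard, hv⟩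
      obtain ⟨x, y, hxy, rfl⟩ := Finset.card_eq_two.mp hcard
      simp only [Finset.mem_insert, Finset.mem_singleton] at hv
      rcases hv with rfl | rfl
      · exact ⟨y, ⟨hxy, he⟩, rfl⟩
      · exact ⟨x, ⟨hxy.symm, by rwa [Finset.pair_comm]⟩, Finset.pair_comm _ _⟩
    · rintro ⟨a, ⟨hva, ha⟩, rfl⟩
      exact ⟨ha, Finset.card_pair hva, by simp⟩
  rw [degree, this, Set.InjOn.ncard_image]
  · rfl
  · rintro a ⟨hva, -⟩ b - hab
    have : a ∈ ({v, b} : Finset V) := by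
      rw [← show ({v, a} : Finset V) = {v, b} from hab]; simp
    simpa [hva.symm] using this

section Link

variable {V : Type*} [Fintype V] [DecidableEq V] {K : AbstractSimplicialComplex V}

theorem link_two_regular (hK : K.IsSphereTriangulation) (v : V) (a : K.Neighbor v) :
    ∃ c d : K.Neighbor v, c ≠ d ∧ ∀ e : K.Neighbor v, K.IsTriangle v a e ↔ e = c ∨ e = d := by
  obtain ⟨c, d, hcd, h⟩ := exists_isTriangle_iff hK a.2.1 a.2.2
  have hc := (h c).mpr (Or.inl rfl)
  have hd := (h d).mpr (Or.inr rfl)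
  refine ⟨⟨c, hc.2.1, hc.swap₂₃.edge_mem⟩, ⟨d, hd.2.1, hd.swap₂₃.edge_mem⟩,
    fun hcd' => hcd (congrArg Subtype.val hcd'), fun e => ?_⟩
  rw [h, Subtype.ext_iff, Subtype.ext_iff]

theorem link_connected (hK : K.IsSphereTriangulation) (v : V) (A : Set (K.Neighbor v))
    (hA : A.Nonempty) (hclosed : ∀ a b : K.Neighbor v, a ∈ A → K.IsTriangle v a b → b ∈ A)
    (b : K.Neighbor v) : b ∈ A := by
  obtain ⟨a, ha⟩ := hA
  have := mem_of_link_closed hK a.2.1 b.2.1 a.2.2 b.2.2 (A := Subtype.val '' A) ⟨a, ha, rfl⟩ ?_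
  · obtain ⟨b', hb', h⟩ := this
    rwa [← Subtype.ext h]
  · rintro _ d ⟨c, hc, rfl⟩ hT
    exact ⟨⟨d, hT.2.1, hT.swap₂₃.edge_mem⟩, hclosed c _ hc hT, rfl⟩

/-- `φ a b` is the label of the flag `v`, `{v, a}`, `{v, a, b}`: exchanging `a` and `b` changes the
edge, replacing `b` changes the triangle. -/
theorem exists_link_labelling (hK : K.IsSphereTriangulation) (v : V) {G : Type*} [Group G]
    {s t : G} (hs : s * s = 1) (ht : t * t = 1) (h : orderOf (s * t) ∣ K.degree v) :
    ∃ φ : V → V → G, (∀ a b, K.IsTriangle v a b → φ b a = φ a b * s) ∧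
      ∀ a b c, K.IsTriangle v a b → K.IsTriangle v a c → b ≠ c → φ a c = φ a b * t := by
  classical
  obtain ⟨φ, h₁, h₂⟩ := exists_dart_labelling (X := K.Neighbor v)
    (R := fun a b => K.IsTriangle v a b) (fun _ _ h => h.swap₂₃) (fun _ h => h.2.2.1 rfl)
    (link_two_regular hK v) (link_connected hK v) hs ht (pow_orderOf_eq_one _)
    (by rwa [card_neighbor])
  have hmem : ∀ {a b}, K.IsTriangle v a b → v ≠ a ∧ {v, a} ∈ K := fun h => ⟨h.1, h.edge_mem⟩
  refine ⟨fun a b => if h : (v ≠ a ∧ {v, a} ∈ K) ∧ (v ≠ b ∧ {v, b} ∈ K) then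
    φ ⟨a, h.1⟩ ⟨b, h.2⟩ else 1, fun a b hab => ?_, fun a b c hab hac hbc => ?_⟩
  · have ha := hmem hab
    have hb := hmem hab.swap₂₃
    simp only [dif_pos (And.intro ha hb), dif_pos (And.intro hb ha)]
    exact h₁ ⟨a, ha⟩ ⟨b, hb⟩ hab
  · have ha := hmem hab
    have hb := hmem hab.swap₂₃
    have hc := hmem hac.swap₂₃
    simp only [dif_pos (And.intro ha hb), dif_pos (And.intro ha hc)]
    exact h₂ ⟨a, ha⟩ ⟨b, hb⟩ ⟨c, hc⟩ hab hac fun h => hbc (congrArg Subtype.val h)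

theorem orderOf_dvd_degree (hK : K.IsSphereTriangulation) (v : V) {G : Type*} [Group G]
    {s t : G} {φ : V → V → G} (h₁ : ∀ a b, K.IsTriangle v a b → φ b a = φ a b * s)
    (h₂ : ∀ a b c, K.IsTriangle v a b → K.IsTriangle v a c → b ≠ c → φ a c = φ a b * t) :
    orderOf (s * t) ∣ K.degree v := by
  rw [← card_neighbor]
  exact orderOf_dvd_card_of_dart_labelling (X := K.Neighbor v)
    (R := fun a b => K.IsTriangle v a b) (fun _ _ h => h.swap₂₃) (fun _ h => h.2.2.1 rfl)
    (link_two_regular hK v) (link_connected hK v) (φ := fun a b => φ a b)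
    (fun a b => h₁ a b) fun a b c hab hac hbc => h₂ a b c hab hac fun h => hbc (Subtype.ext h)

/-- If the degrees of all vertices but one are divisible by the order of `s * t`, where `r`, `s`,
`t` satisfy the Coxeter relations of a triangulation, then so is the remaining one. -/
theorem orderOf_dvd_degree_of_forall_ne (hK : K.IsSphereTriangulation) {G : Type*} [Group G]
    {r s t : G} (hr : r * r = 1) (hs : s * s = 1) (ht : t * t = 1)
    (hrs : r * s * r = s * r * s) (hrt : r * t = t * r) (v₀ : V)
    (h : ∀ v, v ≠ v₀ → orderOf (s * t) ∣ K.degree v) : orderOf (s * t) ∣ K.degree v₀ := by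
  classical
  have hex : ∀ v, ∃ φ : V → V → G, v ≠ v₀ → (∀ a b, K.IsTriangle v a b → φ b a = φ a b * s) ∧
      ∀ a b c, K.IsTriangle v a b → K.IsTriangle v a c → b ≠ c → φ a c = φ a b * t := by
    intro v
    by_cases hv : v = v₀
    · exact ⟨fun _ _ => 1, fun h => absurd hv h⟩
    · obtain ⟨φ, hφ⟩ := exists_link_labelling hK v hs ht (h v hv)
      exact ⟨φ, fun _ => hφ⟩
  choose φ hφ using hex
  have hrr : ∀ g : G, g * r * r = g := fun g => by rw [mul_assoc, hr, mul_one]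
  have hss : ∀ g : G, g * s * s = g := fun g => by rw [mul_assoc, hs, mul_one]
  -- The transition between the labellings at adjacent vertices
  have htrans : ∀ u v, ∃ c : G, (∀ x, K.IsTriangle u v x → u ≠ v₀ → v ≠ v₀ →
      c = φ u v x * r * (φ v u x)⁻¹) ∧ (u = v → c = 1) := by
    intro u v
    by_cases hx : ∃ x, K.IsTriangle u v x
    · obtain ⟨x, hx⟩ := hx
      refine ⟨φ u v x * r * (φ v u x)⁻¹, fun y hy hu hv => ?_, fun huv => absurd huv hx.1⟩
      -- Passing to the other triangle on `uv` multiplies both labels by `t`, which cancels since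
      -- `t` commutes with `r`.
      by_cases hxy : x = y
      · rw [hxy]
      · rw [(hφ u hu).2 v x y hx hy hxy, (hφ v hv).2 u x y hx.swap₁₂ hy.swap₁₂ hxy, mul_inv_rev,
          mul_assoc (φ u v x) t, ← hrt]
        group
    · exact ⟨1, fun x hx' => absurd ⟨x, hx'⟩ hx, fun _ => rfl⟩
  choose c hc hc1 using htrans
  have hcocycle : ∀ u v w, u ≠ v₀ → v ≠ v₀ → w ≠ v₀ → {u, v, w} ∈ K → c u v * c v w = c u w := by
    intro u v w hu hv hw huvw
    by_cases huv : u = v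
    · subst huv
      rw [hc1 u u rfl, one_mul]
    by_cases hvw : v = w
    · subst hvw
      rw [hc1 v v rfl, mul_one]
    by_cases huw : u = w
    · subst huw
      obtain ⟨x, _, _, hx⟩ := exists_isTriangle_iff hK huv
        (K.mem_of_subset huvw (by grind) (by simp))
      have hx := (hx x).mpr (Or.inl rfl)
      rw [hc _ _ x hx hu hv, hc _ _ x hx.swap₁₂ hv hu, hc1 u u rfl,
        mul_assoc, mul_assoc (φ v u x), inv_mul_cancel_left, ← mul_assoc, hrr, mul_inv_cancel]
    -- For a genuine triangle the cocycle condition is the braid relation `hrs`.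
    have hT : K.IsTriangle u v w := ⟨huv, huw, hvw, huvw⟩
    rw [hc u v w hT hu hv, hc v w u hT.swap₁₂.swap₂₃ hv hw, hc u w v hT.swap₂₃ hu hw,
      (hφ v hv).1 u w hT.swap₁₂, (hφ u hu).1 v w hT,
      (hφ w hw).1 u v hT.swap₂₃.swap₁₂]
    calc _ = φ u v w * (r * s * r) * s⁻¹ * (φ w u v)⁻¹ := by group
      _ = _ := by rw [hrs]; group
  obtain ⟨g, hg⟩ := exists_potential hK hcocycle
  -- The flag at `v₀` along `{v₀, a}` is labelled from the corrected label of its neighbour at `a`,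
  -- times `r` for the change of vertex. The rule for `s` uses the braid relation, that for `t` uses
  -- `rt = tr`.
  refine orderOf_dvd_degree hK v₀ (φ := fun a b => g a * φ a v₀ b * r) (fun a b hab => ?_)
    fun a b b' hab hab' hbb => ?_
  · have ha := hab.1.symm
    have hb := hab.2.1.symm
    have habv : K.IsTriangle a b v₀ := hab.swap₁₂.swap₂₃
    rw [← hg a b hab.2.2.1 ha hb habv.edge_mem, hc a b v₀ habv ha hb,
      (hφ b hb).1 a v₀ habv.swap₁₂, (hφ a ha).1 v₀ b hab.swap₁₂]
    calc _ = g a * φ a v₀ b * s * (r * s * r) := by group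
      _ = g a * φ a v₀ b * s * s * r * s := by rw [hrs]; group
      _ = _ := by rw [hss]
  · rw [(hφ a hab.1.symm).2 v₀ b b' hab.swap₁₂ hab'.swap₁₂ hbb]
    simp only [mul_assoc, hrt]

end Link

end AbstractSimplicialComplex

theorem mainTheorem4 {V : Type*} [Fintype V] (K : AbstractSimplicialComplex V)
    (hK : K.IsSphereTriangulation) :
    ¬ ∃ v₀ : V, ¬ 5 ∣ K.degree v₀ ∧ ∀ v : V, v ≠ v₀ → 5 ∣ K.degree v := by
  classical
  rintro ⟨v₀, hv₀, h⟩
  obtain ⟨r, s, t, hr, hs, ht, hrs, hrt, hord⟩ := exists_icosahedral_reflections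
  rw [← hord] at hv₀ h
  exact hv₀ (AbstractSimplicialComplex.orderOf_dvd_degree_of_forall_ne hK hr hs ht hrs hrt v₀ h)
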